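/- Let $\Lambda$ be a ring (associative, with unit, not necessarily commutative), and let $A$ be a finitely presented right $\Lambda$-module of finite length. Consider $\mathrm{Tor}_1^{\Lambda}(A,-)$ as a functor from the category of all left $\Lambda$-modules to the category of abelian groups. Let $F$ be a functor from left $\Lambda$-modules to abelian groups which is a direct summand of $\mathrm{Tor}_1^{\Lambda}(A,-)$, i.e. there are natural transformations $\iota : F \to \mathrm{Tor}_1^{\Lambda}(A,-)$ and $\pi : \mathrm{Tor}_1^{\Lambda}(A,-) \to F$ with $\pi\iota = 1_F$. Then there is a finitely presented submodule $B$ of $A$ (automatically of finite length) such that $F \simeq \mathrm{Tor}_1^{\Lambda}(B,-)$ as functors. -/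

import Mathlib

open CategoryTheory TensorProduct MulOpposite

universe u

namespace NCTensor

section Construction

variable (R : Type u) [Ring R] (A : Type u) [AddCommGroup A] [Module Rᵐᵒᵖ A]

/-- Right `R`-modules are modules over `Rᵐᵒᵖ`, with `a · r = op r • a`.  This is the subgroup of
`A ⊗ M` (tensor product over `ℤ`) generated by the elements `(a · r) ⊗ m - a ⊗ (r • m)`. -/
def relations (M : Type u) [AddCommGroup M] [Module R M] : Submodule ℤ (A ⊗[ℤ] M) :=
  Submodule.span ℤ {x | ∃ (a : A) (r : R) (m : M), x = (op r • a) ⊗ₜ[ℤ] m - a ⊗ₜ[ℤ] (r • m)}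

/-- The tensor product over an arbitrary ring `R` of a right module `A` and a left module `M`,
an abelian group. -/
abbrev Tens (M : Type u) [AddCommGroup M] [Module R M] : Type u :=
  (A ⊗[ℤ] M) ⧸ relations R A M

theorem relations_le_comap {M N : Type u} [AddCommGroup M] [Module R M] [AddCommGroup N]
    [Module R N] (g : M →ₗ[R] N) :
    relations R A M ≤
      (relations R A N).comap (LinearMap.lTensor A g.toAddMonoidHom.toIntLinearMap) := by
  refine Submodule.span_le.2 ?_
  rintro _ ⟨a, r, m, rfl⟩
  refine Submodule.subset_span ⟨a, r, g m, ?_⟩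
  simp

/-- The homomorphism `a ⊗ m ↦ a ⊗ g m` induced by a linear map `g` of left modules. -/
def tensMap {M N : Type u} [AddCommGroup M] [Module R M] [AddCommGroup N] [Module R N]
    (g : M →ₗ[R] N) : Tens R A M →ₗ[ℤ] Tens R A N :=
  Submodule.mapQ _ _ (LinearMap.lTensor A g.toAddMonoidHom.toIntLinearMap)
    (relations_le_comap R A g)

theorem tensMap_mk_tmul {M N : Type u} [AddCommGroup M] [Module R M] [AddCommGroup N]
    [Module R N] (g : M →ₗ[R] N) (a : A) (m : M) :
    tensMap R A g (Submodule.Quotient.mk (a ⊗ₜ[ℤ] m)) = Submodule.Quotient.mk (a ⊗ₜ[ℤ] g m) :=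
  rfl

variable {R A} in
theorem tens_hom_ext {M : Type u} [AddCommGroup M] [Module R M] {C : Type u} [AddCommGroup C]
    {f g : Tens R A M →+ C}
    (h : ∀ (a : A) (m : M), f (Submodule.Quotient.mk (a ⊗ₜ[ℤ] m)) =
      g (Submodule.Quotient.mk (a ⊗ₜ[ℤ] m))) : f = g := by
  ext x
  obtain ⟨x, rfl⟩ := Submodule.Quotient.mk_surjective _ x
  induction x with
  | zero => simp
  | tmul a m => exact h a m
  | add x y hx hy => rw [Submodule.Quotient.mk_add, map_add, map_add, hx, hy]

/-- The functor `A ⊗ -` from left `R`-modules to abelian groups. -/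
def tensFunctor : ModuleCat.{u} R ⥤ AddCommGrpCat.{u} where
  obj M := AddCommGrpCat.of (Tens R A M)
  map g := AddCommGrpCat.ofHom (tensMap R A g.hom).toAddMonoidHom
  map_id M := by
    ext1
    exact tens_hom_ext fun a m => rfl
  map_comp f g := by
    ext1
    exact tens_hom_ext fun a m => rfl

instance : (tensFunctor R A).Additive where
  map_add {M N f g} := by
    ext1
    refine tens_hom_ext fun a m => ?_
    change Submodule.Quotient.mk (a ⊗ₜ[ℤ] (f.hom m + g.hom m)) =
      (Submodule.Quotient.mk (a ⊗ₜ[ℤ] f.hom m) + Submodule.Quotient.mk (a ⊗ₜ[ℤ] g.hom m) :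
        Tens R A N)
    rw [TensorProduct.tmul_add, Submodule.Quotient.mk_add]

/-- The functor `Tor_n(A, -)` from left `R`-modules to abelian groups: the `n`-th left derived
functor of `A ⊗ -`. -/
noncomputable def Tor (n : ℕ) : ModuleCat.{u} R ⥤ AddCommGrpCat.{u} :=
  (tensFunctor R A).leftDerived n

end Construction

end NCTensor

/-! Present `A` by generators `a` and a relation matrix `D`. A family `x` in `M` with `D x = 0` is a
map from the transpose of `A` to `M`, and it determines a class in `Tor_1(A, M)`; every class arises
so, naturally in `M`. Hence `Tor_1(A, -)` is generated by one class `t` over the transpose, and a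
natural endomorphism is determined by the image of `t`. Lifting that image to matrices with `E D = D
C` gives an endomorphism of `A` inducing it (`exists_torMap_eq`).

Let `e` induce the idempotent that cuts out `F`. Every positive power of `e` induces the same
idempotent, and by Fitting's lemma a high power `f` satisfies `A = ker f ⊕ im f`. Then `f` factors
through `B = im f`, with `B → A → B` invertible, so the idempotent splits through `Tor_1(B, -)`
(`nonempty_iso_of_retract`). -/

namespace NCTensor

/-! ### Functoriality of the tensor product and of Tor in the right module -/

section Tensor

variable {R : Type u} [Ring R] {A B C : Type u} [AddCommGroup A] [Module Rᵐᵒᵖ A]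
  [AddCommGroup B] [Module Rᵐᵒᵖ B] [AddCommGroup C] [Module Rᵐᵒᵖ C]
  {M N : Type u} [AddCommGroup M] [Module R M] [AddCommGroup N] [Module R N]

/-- The biadditive map `(a, m) ↦ a ⊗ m` into the tensor product over `R`. -/
def tensMk : A →+ M →+ Tens R A M :=
  AddMonoidHom.mk' (fun a => AddMonoidHom.mk' (fun m => Submodule.Quotient.mk (a ⊗ₜ[ℤ] m))
    fun m m' => by rw [TensorProduct.tmul_add, Submodule.Quotient.mk_add])
    fun a a' => by
      ext m
      simp [TensorProduct.add_tmul, Submodule.Quotient.mk_add]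

theorem tensMk_apply (a : A) (m : M) :
    tensMk (R := R) a m = Submodule.Quotient.mk (a ⊗ₜ[ℤ] m) := rfl

theorem tensMk_op_smul (r : R) (a : A) (m : M) :
    tensMk (R := R) (op r • a) m = tensMk a (r • m) := by
  rw [tensMk_apply, tensMk_apply, Submodule.Quotient.eq]
  exact Submodule.subset_span ⟨a, r, m, rfl⟩

theorem tensMap_tensMk (g : M →ₗ[R] N) (a : A) (m : M) :
    tensMap R A g (tensMk a m) = tensMk a (g m) := rfl

/-- The universal property of the tensor product over `R`. -/
def tensLift {G : Type*} [AddCommGroup G] (β : A →+ M →+ G)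
    (h : ∀ (r : R) a m, β (op r • a) m = β a (r • m)) : Tens R A M →ₗ[ℤ] G :=
  Submodule.liftQ _ (TensorProduct.liftAddHom β (by simp)).toIntLinearMap <| by
    refine Submodule.span_le.2 ?_
    rintro _ ⟨a, r, m, rfl⟩
    simp [h]

theorem tensLift_tensMk {G : Type*} [AddCommGroup G] (β : A →+ M →+ G)
    (h : ∀ (r : R) a m, β (op r • a) m = β a (r • m)) (a : A) (m : M) :
    tensLift β h (tensMk a m) = β a m := rfl

/-- The homomorphism `a ⊗ m ↦ f a ⊗ m` induced by a linear map `f` of right modules. -/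
def tensMapLeft (f : A →ₗ[Rᵐᵒᵖ] B) : Tens R A M →ₗ[ℤ] Tens R B M :=
  tensLift (tensMk.comp f.toAddMonoidHom) fun r a m => by
    simp [tensMk_op_smul]

theorem tensMapLeft_tensMk (f : A →ₗ[Rᵐᵒᵖ] B) (a : A) (m : M) :
    tensMapLeft f (tensMk (R := R) a m) = tensMk (f a) m := rfl

variable (R) in
/-- The natural transformation `A ⊗ - ⟶ B ⊗ -` induced by a linear map of right modules. -/
def tensFunctorMap (f : A →ₗ[Rᵐᵒᵖ] B) : tensFunctor R A ⟶ tensFunctor R B where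
  app M := AddCommGrpCat.ofHom (tensMapLeft (M := M) f).toAddMonoidHom
  naturality M N g := by
    ext1
    exact tens_hom_ext fun a m => rfl

theorem tensFunctorMap_id : tensFunctorMap R (LinearMap.id : A →ₗ[Rᵐᵒᵖ] A) = 𝟙 _ := by
  ext M : 3
  exact tens_hom_ext fun a m => rfl

theorem tensFunctorMap_comp (f : A →ₗ[Rᵐᵒᵖ] B) (g : B →ₗ[Rᵐᵒᵖ] C) :
    tensFunctorMap R (g ∘ₗ f) = tensFunctorMap R f ≫ tensFunctorMap R g := by
  ext M : 3
  exact tens_hom_ext fun a m => rfl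

variable (R) in
/-- `Tor_n(-, -)` is functorial in the right module. -/
noncomputable def torMap (f : A →ₗ[Rᵐᵒᵖ] B) (n : ℕ) : Tor R A n ⟶ Tor R B n :=
  NatTrans.leftDerived (tensFunctorMap R f) n

theorem torMap_id (n : ℕ) : torMap R (LinearMap.id : A →ₗ[Rᵐᵒᵖ] A) n = 𝟙 _ := by
  rw [torMap, tensFunctorMap_id, NatTrans.leftDerived_id]
  rfl

theorem torMap_comp (f : A →ₗ[Rᵐᵒᵖ] B) (g : B →ₗ[Rᵐᵒᵖ] C) (n : ℕ) :
    torMap R (g ∘ₗ f) n = torMap R f n ≫ torMap R g n := by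
  rw [torMap, tensFunctorMap_comp, NatTrans.leftDerived_comp]
  rfl

end Tensor

/-! ### Finite presentations and right exactness in matrix form -/

section Presentation

variable {R : Type u} [Ring R] {A : Type u} [AddCommGroup A] [Module Rᵐᵒᵖ A]
  {ι κ : Type*} [Fintype ι] [Fintype κ]

/-- The family `a` generates the right module `A`, and the columns of the matrix `D` generate
the module of relations between the `a i`. -/
structure IsPresentation (a : ι → A) (D : ι → κ → R) : Prop where
  exists_eq_sum : ∀ x : A, ∃ c : ι → R, x = ∑ i, op (c i) • a i
  sum_eq_zero_iff : ∀ c : ι → R, ∑ i, op (c i) • a i = 0 ↔ ∃ k : κ → R, ∀ i, c i = ∑ j, D i j * k j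

theorem exists_isPresentation (h : Module.FinitePresentation Rᵐᵒᵖ A) :
    ∃ (n m : ℕ) (a : Fin n → A) (D : Fin n → Fin m → R), IsPresentation a D := by
  obtain ⟨n, a, ha⟩ := Module.Finite.exists_fin (R := Rᵐᵒᵖ) (M := A)
  have hsurj : Function.Surjective (Fintype.linearCombination Rᵐᵒᵖ a) := by
    rw [← LinearMap.range_eq_top, Fintype.range_linearCombination, ha]
  obtain ⟨m, d, hd⟩ := Submodule.fg_iff_exists_fin_generating_family.1
    (Module.FinitePresentation.fg_ker _ hsurj)
  refine ⟨n, m, a, fun i j => unop (d j i), fun x => ?_, fun c => ?_⟩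
  · obtain ⟨c, rfl⟩ := hsurj x
    exact ⟨fun i => unop (c i), by simp [Fintype.linearCombination_apply]⟩
  · have : ∑ i, op (c i) • a i = 0 ↔ (fun i => op (c i)) ∈
        LinearMap.ker (Fintype.linearCombination Rᵐᵒᵖ a) := by
      simp [Fintype.linearCombination_apply]
    rw [this, ← hd, Submodule.mem_span_range_iff_exists_fun]
    constructor
    · rintro ⟨k, hk⟩
      refine ⟨fun j => unop (k j), fun i => ?_⟩
      have := congrArg unop (congrFun hk i)
      simpa using this.symm
    · rintro ⟨k, hk⟩
      refine ⟨fun j => op (k j), funext fun i => ?_⟩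
      simp [hk]

namespace IsPresentation

variable {a : ι → A} {D : ι → κ → R} (hD : IsPresentation a D)
include hD

theorem sum_col_eq_zero (j : κ) : ∑ i, op (D i j) • a i = 0 := by
  classical
  exact (hD.sum_eq_zero_iff _).2 ⟨Pi.single j 1, fun i => by simp [Pi.single_apply]⟩

/-- Additive maps out of a presented module. -/
theorem exists_addMonoidHom {G : Type*} [AddCommGroup G] (f : (ι → R) →+ G)
    (hf : ∀ k : κ → R, f (fun i => ∑ j, D i j * k j) = 0) :
    ∃ g : A →+ G, ∀ c : ι → R, g (∑ i, op (c i) • a i) = f c := by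
  let φ : (ι → R) →+ A := AddMonoidHom.mk' (fun c => ∑ i, op (c i) • a i) fun c c' => by
    simp [add_smul, Finset.sum_add_distrib]
  have hφ : Function.Surjective φ := fun x => by
    obtain ⟨c, hc⟩ := hD.exists_eq_sum x
    exact ⟨c, hc.symm⟩
  have hk : φ.ker ≤ f.ker := fun c hc => by
    obtain ⟨k, hk⟩ := (hD.sum_eq_zero_iff c).1 hc
    rw [AddMonoidHom.mem_ker, funext hk, hf]
  exact ⟨φ.liftOfSurjective hφ ⟨f, hk⟩, fun c => φ.liftOfRightInverse_comp_apply _ _ ⟨f, hk⟩ c⟩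

/-- Endomorphisms of a presented module given by compatible matrices. -/
theorem exists_end (E : ι → ι → R) (C : κ → κ → R)
    (hEC : ∀ i j, ∑ l, E i l * D l j = ∑ l, D i l * C l j) :
    ∃ e : A →ₗ[Rᵐᵒᵖ] A, ∀ l, e (a l) = ∑ i, op (E i l) • a i := by
  classical
  let f : (ι → R) →+ A := AddMonoidHom.mk' (fun c => ∑ i, op (∑ l, E i l * c l) • a i)
    fun c c' => by simp [mul_add, add_smul, Finset.sum_add_distrib]
  obtain ⟨g, hg⟩ := hD.exists_addMonoidHom f fun k => by
    -- Since `E D = D C`, the relation `D k` is sent to the relation `D (C k)`.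
    refine (hD.sum_eq_zero_iff _).2 ⟨fun l => ∑ j, C l j * k j, fun i => ?_⟩
    calc ∑ l, E i l * ∑ j, D l j * k j = ∑ j, (∑ l, E i l * D l j) * k j := by
          simp only [Finset.mul_sum, Finset.sum_mul, mul_assoc]
          exact Finset.sum_comm
      _ = ∑ l, D i l * ∑ j, C l j * k j := by
          simp only [hEC, Finset.mul_sum, Finset.sum_mul, mul_assoc]
          exact Finset.sum_comm
  refine ⟨{ g with map_smul' := fun r x => ?_ }, fun l => ?_⟩
  · obtain ⟨c, rfl⟩ := hD.exists_eq_sum x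
    have : r • ∑ i, op (c i) • a i = ∑ i, op (c i * unop r) • a i := by
      simp [Finset.smul_sum, smul_smul]
    change g (r • ∑ i, op (c i) • a i) = r • g (∑ i, op (c i) • a i)
    rw [this, hg, hg]
    simp [f, Finset.smul_sum, smul_smul, Finset.mul_sum, mul_assoc]
  · have : a l = ∑ i, op ((Pi.single l 1 : ι → R) i) • a i := by
      simp [Pi.single_apply, apply_ite op, ite_smul]
    change g (a l) = _
    conv_lhs => rw [this, hg]
    simp only [f, AddMonoidHom.mk'_apply, Pi.single_apply, mul_ite, mul_one, mul_zero,
      Finset.sum_ite_eq', Finset.mem_univ, if_true]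

variable {M : Type u} [AddCommGroup M] [Module R M]

theorem exists_eq_sum_tensMk (z : Tens R A M) : ∃ p : ι → M, z = ∑ i, tensMk (a i) (p i) := by
  obtain ⟨z, rfl⟩ := Submodule.Quotient.mk_surjective _ z
  induction z with
  | zero => exact ⟨0, by simp⟩
  | tmul x m =>
    obtain ⟨c, rfl⟩ := hD.exists_eq_sum x
    refine ⟨fun i => c i • m, ?_⟩
    simp_rw [← tensMk_op_smul]
    rw [← tensMk_apply, map_sum, AddMonoidHom.finsetSum_apply]
  | add x y hx hy =>
    obtain ⟨p, hp⟩ := hx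
    obtain ⟨q, hq⟩ := hy
    exact ⟨p + q, by simp [hp, hq, Submodule.Quotient.mk_add, Finset.sum_add_distrib]⟩

theorem sum_tensMk_eq_zero (q : κ → M) : ∑ i, tensMk (R := R) (a i) (∑ j, D i j • q j) = 0 := by
  simp only [map_sum, ← tensMk_op_smul]
  rw [Finset.sum_comm]
  refine Finset.sum_eq_zero fun j _ => ?_
  rw [← AddMonoidHom.finsetSum_apply, ← map_sum, hD.sum_col_eq_zero, map_zero,
    AddMonoidHom.zero_apply]

/-- The vanishing criterion for the tensor product, from right exactness. -/
theorem exists_of_sum_tensMk_eq_zero (p : ι → M) (hp : ∑ i, tensMk (R := R) (a i) (p i) = 0) :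
    ∃ q : κ → M, ∀ i, p i = ∑ j, D i j • q j := by
  classical
  -- The claim is that `p` vanishes in the cokernel of `D` on families in `M`. A map from `A ⊗ M` to
  -- this cokernel is built, sending `a l ⊗ m` to the class of `m` in coordinate `l`.
  let S : AddSubgroup (ι → M) := AddMonoidHom.range (AddMonoidHom.mk'
    (fun (q : κ → M) i => ∑ j, D i j • q j) fun q q' => by
      ext i; simp [Finset.sum_add_distrib])
  let β : (ι → R) →+ (M →+ (ι → M) ⧸ S) := AddMonoidHom.mk' (fun c =>
    (QuotientAddGroup.mk' S).comp (AddMonoidHom.mk' (fun m i => c i • m) fun m m' => by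
      ext i; simp)) fun c c' => by
        ext m
        simp only [AddMonoidHom.comp_apply, AddMonoidHom.add_apply, ← map_add]
        congr 1
        ext i
        simp [add_smul]
  obtain ⟨γ, hγ⟩ := hD.exists_addMonoidHom β fun k => by
    ext m
    refine (QuotientAddGroup.eq_zero_iff _).2 ⟨fun j => k j • m, ?_⟩
    ext i
    simp [Finset.sum_smul, smul_smul]
  have hmul : ∀ (r : R) x m, γ (op r • x) m = γ x (r • m) := fun r x m => by
    obtain ⟨c, rfl⟩ := hD.exists_eq_sum x
    have : op r • ∑ i, op (c i) • a i = ∑ i, op (c i * r) • a i := by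
      simp [Finset.smul_sum, smul_smul]
    rw [this, hγ, hγ]
    change QuotientAddGroup.mk' S _ = QuotientAddGroup.mk' S _
    congr 1
    ext i
    simp [smul_smul]
  have ha : ∀ l m, γ (a l) m = QuotientAddGroup.mk' S (Pi.single l m) := fun l m => by
    have : a l = ∑ i, op ((Pi.single l 1 : ι → R) i) • a i := by
      simp [Pi.single_apply, apply_ite op, ite_smul]
    rw [this, hγ]
    change QuotientAddGroup.mk' S _ = QuotientAddGroup.mk' S _
    congr 1
    ext i
    simp [Pi.single_apply, ite_smul]
  have h0 := congrArg (tensLift γ hmul) hp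
  simp only [map_sum, tensLift_tensMk, ha, map_zero] at h0
  rw [← map_sum, Finset.univ_sum_single] at h0
  obtain ⟨q, hq⟩ := (QuotientAddGroup.eq_zero_iff _).1 h0
  exact ⟨q, fun i => (congrFun hq i).symm⟩

end IsPresentation

end Presentation

/-! ### Cycles and their classes in degree one -/

section HomologyClass

variable {K L : ChainComplex AddCommGrpCat.{u} ℕ}

/-- The element `z` of degree one is a cycle with homology class `t`. -/
def IsHomologyClass (K : ChainComplex AddCommGrpCat.{u} ℕ) (z : K.X 1) (t : K.homology 1) : Prop :=
  ∃ c : K.cycles 1, K.iCycles 1 c = z ∧ K.homologyπ 1 c = t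

theorem exists_isHomologyClass (t : K.homology 1) : ∃ z, IsHomologyClass K z t := by
  obtain ⟨c, hc⟩ := (AddCommGrpCat.epi_iff_surjective (K.homologyπ 1)).1 inferInstance t
  exact ⟨_, c, rfl, hc⟩

theorem IsHomologyClass.d_eq_zero {z : K.X 1} {t : K.homology 1} (h : IsHomologyClass K z t) :
    K.d 1 0 z = 0 := by
  obtain ⟨c, rfl, -⟩ := h
  rw [← ConcreteCategory.comp_apply, K.iCycles_d]
  rfl

theorem exists_isHomologyClass_of_d_eq_zero (z : K.X 1) (hz : K.d 1 0 z = 0) :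
    ∃ t, IsHomologyClass K z t := by
  have hz' : (K.sc 1).g z = 0 := by
    change K.d 1 ((ComplexShape.down ℕ).next 1) z = 0
    rwa [ChainComplex.next_nat_succ]
  exact ⟨_, (ShortComplex.abCyclesIso (K.sc 1)).inv ⟨z, hz'⟩,
    ShortComplex.abCyclesIso_inv_apply_iCycles (K.sc 1) ⟨z, hz'⟩, rfl⟩

theorem iCycles_injective (i : ℕ) : Function.Injective (K.iCycles i) :=
  (AddCommGrpCat.mono_iff_injective _).1 inferInstance

theorem IsHomologyClass.eq_of_sub_eq_d {z z' : K.X 1} {t t' : K.homology 1}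
    (h : IsHomologyClass K z t) (h' : IsHomologyClass K z' t') (w : K.X 2)
    (hw : z - z' = K.d 2 1 w) : t = t' := by
  obtain ⟨c, rfl, rfl⟩ := h
  obtain ⟨c', rfl, rfl⟩ := h'
  have hc : c - c' = K.toCycles 2 1 w := by
    apply iCycles_injective
    rw [map_sub, hw, ← ConcreteCategory.comp_apply, K.toCycles_i]
  rw [← sub_eq_zero, ← map_sub, hc, ← ConcreteCategory.comp_apply, K.toCycles_comp_homologyπ]
  rfl

theorem IsHomologyClass.map {z : K.X 1} {t : K.homology 1} (h : IsHomologyClass K z t)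
    (φ : K ⟶ L) : IsHomologyClass L (φ.f 1 z) (HomologicalComplex.homologyMap φ 1 t) := by
  obtain ⟨c, rfl, rfl⟩ := h
  refine ⟨HomologicalComplex.cyclesMap φ 1 c, ?_, ?_⟩
  · rw [← ConcreteCategory.comp_apply, HomologicalComplex.cyclesMap_i, ConcreteCategory.comp_apply]
  · rw [← ConcreteCategory.comp_apply, ← HomologicalComplex.homologyπ_naturality,
      ConcreteCategory.comp_apply]

end HomologyClass

/-! ### Projective resolutions elementwise -/

section Resolution

variable {R : Type u} [Ring R] {M N : ModuleCat.{u} R} (P : ProjectiveResolution M)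
  (Q : ProjectiveResolution N)

/-- The augmentation of a projective resolution of a module, as a linear map. -/
noncomputable def augmentation : P.complex.X 0 →ₗ[R] M := (show P.complex.X 0 ⟶ M from P.π.f 0).hom

theorem augmentation_d (y : P.complex.X 1) : augmentation P ((P.complex.d 1 0).hom y) = 0 :=
  ConcreteCategory.congr_hom P.complex_d_comp_π_f_zero y

theorem augmentation_surjective : Function.Surjective (augmentation P) :=
  (ModuleCat.epi_iff_surjective (P.π.f 0)).1 inferInstance

theorem exists_d_eq_of_augmentation_eq_zero (x : P.complex.X 0) (hx : augmentation P x = 0) :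
    ∃ y : P.complex.X 1, (P.complex.d 1 0).hom y = x :=
  (ShortComplex.moduleCat_exact_iff _).1 P.exact₀ x hx

theorem exists_d_eq_of_d_eq_zero (x : P.complex.X 1) (hx : (P.complex.d 1 0).hom x = 0) :
    ∃ y : P.complex.X 2, (P.complex.d 2 1).hom y = x :=
  (ShortComplex.moduleCat_exact_iff _).1 (P.exact_succ 0) x hx

theorem augmentation_lift (f : M ⟶ N) (x : P.complex.X 0) :
    augmentation Q (((ProjectiveResolution.lift f P Q).f 0).hom x) = f.hom (augmentation P x) :=
  ConcreteCategory.congr_hom (ProjectiveResolution.lift_commutes_zero f P Q) x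

theorem d_chainMap (φ : P.complex ⟶ Q.complex) (x : P.complex.X 1) :
    (Q.complex.d 1 0).hom ((φ.f 1).hom x) = (φ.f 0).hom ((P.complex.d 1 0).hom x) :=
  ConcreteCategory.congr_hom (φ.comm 1 0) x

end Resolution

/-! ### Tor classes from solutions of `D x = 0` -/

section TorClass

variable {R : Type u} [Ring R] {A B : Type u} [AddCommGroup A] [Module Rᵐᵒᵖ A]
  [AddCommGroup B] [Module Rᵐᵒᵖ B] {ι κ : Type*} [Fintype ι] [Fintype κ]

/-- The complex `A ⊗ P` for a projective resolution `P`. -/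
noncomputable abbrev tensComplex (R : Type u) [Ring R] (A : Type u) [AddCommGroup A]
    [Module Rᵐᵒᵖ A] {M : ModuleCat.{u} R} (P : ProjectiveResolution M) :
    ChainComplex AddCommGrpCat.{u} ℕ :=
  ((tensFunctor R A).mapHomologicalComplex _).obj P.complex

/-- The class `t` in `Tor_1(A, M)` is represented by the cycle `z` of `A ⊗ P`. -/
def IsTorCycle {M : ModuleCat.{u} R} (P : ProjectiveResolution M) (z : Tens R A (P.complex.X 1))
    (t : (Tor R A 1).obj M) : Prop :=
  IsHomologyClass (tensComplex R A P) z ((P.isoLeftDerivedObj (tensFunctor R A) 1).hom t)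

section

variable {M N : ModuleCat.{u} R} {P : ProjectiveResolution M} {Q : ProjectiveResolution N}

variable (P) in
theorem exists_isTorCycle (t : (Tor R A 1).obj M) :
    ∃ z : Tens R A (P.complex.X 1), IsTorCycle P z t :=
  exists_isHomologyClass (K := tensComplex R A P) _

theorem IsTorCycle.d_eq_zero {z : Tens R A (P.complex.X 1)} {t : (Tor R A 1).obj M}
    (h : IsTorCycle P z t) : tensMap R A (P.complex.d 1 0).hom z = 0 :=
  IsHomologyClass.d_eq_zero (K := tensComplex R A P) h

theorem exists_isTorCycle_of_d_eq_zero (z : Tens R A (P.complex.X 1))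
    (hz : tensMap R A (P.complex.d 1 0).hom z = 0) :
    ∃ t : (Tor R A 1).obj M, IsTorCycle P z t := by
  obtain ⟨t, ht⟩ := exists_isHomologyClass_of_d_eq_zero (K := tensComplex R A P) z hz
  obtain ⟨s, rfl⟩ :=
    ((P.isoLeftDerivedObj (tensFunctor R A) 1).addCommGroupIsoToAddEquiv).surjective t
  exact ⟨s, ht⟩

theorem IsTorCycle.eq_of_sub_eq_d {z z' : Tens R A (P.complex.X 1)} {t t' : (Tor R A 1).obj M}
    (h : IsTorCycle P z t) (h' : IsTorCycle P z' t') (w : Tens R A (P.complex.X 2))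
    (hw : z - z' = tensMap R A (P.complex.d 2 1).hom w) : t = t' :=
  ((P.isoLeftDerivedObj (tensFunctor R A) 1).addCommGroupIsoToAddEquiv).injective
    (IsHomologyClass.eq_of_sub_eq_d (K := tensComplex R A P) h h' w hw)

theorem IsTorCycle.map {z : Tens R A (P.complex.X 1)} {t : (Tor R A 1).obj M}
    (h : IsTorCycle P z t) (f : M ⟶ N) :
    IsTorCycle Q (tensMap R A ((ProjectiveResolution.lift f P Q).f 1).hom z)
      ((Tor R A 1).map f t) := by
  have h1 := ConcreteCategory.congr_hom (ProjectiveResolution.isoLeftDerivedObj_hom_naturality f P Q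
    (ProjectiveResolution.lift f P Q) (ProjectiveResolution.lift_commutes_zero f P Q)
    (tensFunctor R A) 1) t
  have h2 := IsHomologyClass.map h
    (((tensFunctor R A).mapHomologicalComplex _).map (ProjectiveResolution.lift f P Q))
  exact (congrArg (IsHomologyClass (tensComplex R A Q) _) h1).mpr h2

theorem IsTorCycle.mapLeft {z : Tens R A (P.complex.X 1)} {t : (Tor R A 1).obj M}
    (h : IsTorCycle P z t) (e : A →ₗ[Rᵐᵒᵖ] B) :
    IsTorCycle P (tensMapLeft e z) ((torMap R e 1).app M t) := by
  have h1 := ProjectiveResolution.leftDerived_app_eq (tensFunctorMap R e) P 1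
  rw [← Category.assoc, Iso.eq_comp_inv] at h1
  have h2 := ConcreteCategory.congr_hom h1 t
  have h3 := IsHomologyClass.map h
    ((NatTrans.mapHomologicalComplex (tensFunctorMap R e) _).app P.complex)
  exact (congrArg (IsHomologyClass (tensComplex R B P) _) h2).mpr h3

end

/-- The element of `Tor_1(A, M)` attached to the family `x` of elements of `M` with
`∑ j, D i j • x j = 0`: it is the class of `∑ i, a i ⊗ p i`, where `p` is a lift of the family
`∑ j, D i j • q j` and `q` is a lift of `x`. -/
def IsTorClass (a : ι → A) (D : ι → κ → R) {M : ModuleCat.{u} R} (P : ProjectiveResolution M)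
    (x : κ → M) (t : (Tor R A 1).obj M) : Prop :=
  ∃ (q : κ → P.complex.X 0) (p : ι → P.complex.X 1),
    (∀ j, augmentation P (q j) = x j) ∧ (∀ i, (P.complex.d 1 0).hom (p i) = ∑ j, D i j • q j) ∧
    IsTorCycle P (∑ i, tensMk (a i) (p i)) t

variable {a : ι → A} {D : ι → κ → R} {M N : ModuleCat.{u} R} {P : ProjectiveResolution M}

theorem IsTorClass.map {x : κ → M} {t : (Tor R A 1).obj M} (h : IsTorClass a D P x t)
    (Q : ProjectiveResolution N) (f : M ⟶ N) :
    IsTorClass a D Q (fun j => f.hom (x j)) ((Tor R A 1).map f t) := by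
  obtain ⟨q, p, hq, hp, ht⟩ := h
  let φ := ProjectiveResolution.lift f P Q
  refine ⟨fun j => (φ.f 0).hom (q j), fun i => (φ.f 1).hom (p i), fun j => ?_, fun i => ?_, ?_⟩
  · exact (augmentation_lift P Q f _).trans (congrArg f.hom (hq j))
  · rw [d_chainMap, hp, map_sum]
    exact Finset.sum_congr rfl fun j _ => map_smul (φ.f 0).hom _ _
  · have h3 := ht.map (Q := Q) f
    simp only [map_sum, tensMap_tensMk] at h3
    exact h3

theorem IsTorClass.mapLeft {b : ι → B} {D' : ι → κ → R} {x : κ → M} {t : (Tor R A 1).obj M}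
    (h : IsTorClass a D P x t) (e : A →ₗ[Rᵐᵒᵖ] B) (E : ι → ι → R) (C : κ → κ → R)
    (he : ∀ l, e (a l) = ∑ i, op (E i l) • b i)
    (hEC : ∀ i j, ∑ l, E i l * D l j = ∑ l, D' i l * C l j) :
    IsTorClass b D' P (fun l => ∑ j, C l j • x j) ((torMap R e 1).app M t) := by
  obtain ⟨q, p, hq, hp, ht⟩ := h
  refine ⟨fun l => ∑ j, C l j • q j, fun i => ∑ l, E i l • p l, fun l => ?_, fun i => ?_, ?_⟩
  · simp only [map_sum, map_smul, hq]
  · simp only [map_sum, map_smul, hp, Finset.smul_sum, smul_smul]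
    refine Finset.sum_comm.trans (Eq.trans ?_ Finset.sum_comm)
    simp only [← Finset.sum_smul, hEC]
  · have h3 := ht.mapLeft e
    simp only [map_sum, tensMapLeft_tensMk, he, AddMonoidHom.finsetSum_apply, tensMk_op_smul] at h3
    rw [Finset.sum_comm] at h3
    simpa only [map_sum] using h3

theorem IsPresentation.exists_isTorClass (hD : IsPresentation a D) (P : ProjectiveResolution M)
    (x : κ → M) (hx : ∀ i, ∑ j, D i j • x j = 0) :
    ∃ t : (Tor R A 1).obj M, IsTorClass a D P x t := by
  choose q hq using fun j => augmentation_surjective P (x j)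
  choose p hp using fun i => exists_d_eq_of_augmentation_eq_zero P (∑ j, D i j • q j)
    (by simp only [map_sum, map_smul, hq, hx])
  obtain ⟨t, ht⟩ := exists_isTorCycle_of_d_eq_zero (P := P) (∑ i, tensMk (a i) (p i)) (by
    simp only [map_sum, tensMap_tensMk, hp]
    simpa only [map_sum] using hD.sum_tensMk_eq_zero q)
  exact ⟨t, q, p, hq, hp, ht⟩

/-- Write a representing cycle as `∑ a i ⊗ p i`. Its boundary vanishes in `A ⊗ P₀`, so the vanishing
criterion gives `d p = D q`, and augmenting `q` yields `x`. -/
theorem IsPresentation.exists_isTorClass_of_tor (hD : IsPresentation a D)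
    (P : ProjectiveResolution M) (t : (Tor R A 1).obj M) :
    ∃ x : κ → M, (∀ i, ∑ j, D i j • x j = 0) ∧ IsTorClass a D P x t := by
  obtain ⟨z, hz⟩ := exists_isTorCycle P t
  obtain ⟨p, rfl⟩ := hD.exists_eq_sum_tensMk z
  have h := hz.d_eq_zero
  simp only [map_sum, tensMap_tensMk] at h
  obtain ⟨q, hq⟩ := hD.exists_of_sum_tensMk_eq_zero _ h
  refine ⟨fun j => augmentation P (q j), fun i => ?_, q, p, fun j => rfl, hq, hz⟩
  simp only [← map_smul, ← map_sum, ← hq, augmentation_d]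

/-- Two lifts of `x` differ by some `d r`. Then `p - p' - D r` is a cycle, hence some `d s`; as `∑ a
i ⊗ (D r) i = 0`, the representatives differ by the boundary of `∑ a i ⊗ s i`. -/
theorem IsPresentation.isTorClass_unique (hD : IsPresentation a D) {x : κ → M}
    {t t' : (Tor R A 1).obj M} (h : IsTorClass a D P x t) (h' : IsTorClass a D P x t') :
    t = t' := by
  obtain ⟨q, p, hq, hp, ht⟩ := h
  obtain ⟨q', p', hq', hp', ht'⟩ := h'
  choose r hr using fun j => exists_d_eq_of_augmentation_eq_zero P (q j - q' j)
    (by rw [map_sub, hq, hq', sub_self])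
  choose s hs using fun i => exists_d_eq_of_d_eq_zero P (p i - p' i - ∑ j, D i j • r j) (by
    simp only [map_sub, map_sum, map_smul, hp, hp', hr, smul_sub, Finset.sum_sub_distrib, sub_self])
  refine ht.eq_of_sub_eq_d ht' (∑ i, tensMk (a i) (s i)) ?_
  have := hD.sum_tensMk_eq_zero r
  simp only [map_sum (tensMap R A _), tensMap_tensMk, hs, map_sub, Finset.sum_sub_distrib, this,
    sub_zero]

end TorClass

/-! ### Natural endomorphisms of `Tor_1(A, -)` -/

section NatTrans

variable {R : Type u} [Ring R] {A : Type u} [AddCommGroup A] [Module Rᵐᵒᵖ A]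

/-- The left module with presentation matrix transposed to that of the right module `A`
(the transpose of `A`). -/
abbrev Transpose {n m : ℕ} (D : Fin n → Fin m → R) : Type u :=
  (Fin m → R) ⧸ Submodule.span R (Set.range D)

/-- The canonical generators of the transpose. -/
def transposeGen {n m : ℕ} (D : Fin n → Fin m → R) (j : Fin m) : Transpose D :=
  Submodule.Quotient.mk (Pi.single j 1)

theorem sum_smul_transposeGen {n m : ℕ} (D : Fin n → Fin m → R) (c : Fin m → R) :
    ∑ j, c j • transposeGen D j = Submodule.Quotient.mk c := by
  simp only [transposeGen, ← Submodule.mkQ_apply, ← map_smul, ← map_sum]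
  congr 1
  exact (pi_eq_sum_univ' c).symm

theorem sum_smul_transposeGen_row {n m : ℕ} (D : Fin n → Fin m → R) (i : Fin n) :
    ∑ j, D i j • transposeGen D j = 0 := by
  rw [sum_smul_transposeGen, Submodule.Quotient.mk_eq_zero]
  exact Submodule.subset_span ⟨i, rfl⟩

theorem exists_transpose_linearMap {n m : ℕ} (D : Fin n → Fin m → R) {M : Type u}
    [AddCommGroup M] [Module R M] (x : Fin m → M) (hx : ∀ i, ∑ j, D i j • x j = 0) :
    ∃ f : Transpose D →ₗ[R] M, ∀ j, f (transposeGen D j) = x j := by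
  refine ⟨Submodule.liftQ _ (Fintype.linearCombination R x) (Submodule.span_le.2 ?_), fun j => ?_⟩
  · rintro _ ⟨i, rfl⟩
    simpa [Fintype.linearCombination_apply] using hx i
  · simp [transposeGen, Fintype.linearCombination_apply_single]

/-- Natural endomorphisms of `Tor_1(A, -)` are induced by endomorphisms of `A`, if `A` is finitely
presented. -/
theorem exists_torMap_eq (hA : Module.FinitePresentation Rᵐᵒᵖ A) (τ : Tor R A 1 ⟶ Tor R A 1) :
    ∃ e : A →ₗ[Rᵐᵒᵖ] A, torMap R e 1 = τ := by
  obtain ⟨n, m, a, D, hD⟩ := exists_isPresentation hA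
  let X : ModuleCat.{u} R := ModuleCat.of R (Transpose D)
  let P : ProjectiveResolution X := projectiveResolution X
  obtain ⟨t, ht⟩ := hD.exists_isTorClass P (transposeGen D) (sum_smul_transposeGen_row D)
  obtain ⟨y, hy, hty⟩ := hD.exists_isTorClass_of_tor P (τ.app X t)
  choose C hC using fun j => Submodule.Quotient.mk_surjective _ (y j)
  -- `D y = 0` in the transpose says that the rows of `D C` lie in the row span of `D`; the
  -- coefficients form `E`.
  have hrow : ∀ i, ∃ E : Fin n → R, ∑ l, E l • D l = ∑ k, D i k • C k := fun i => by
    rw [← Submodule.mem_span_range_iff_exists_fun, ← Submodule.Quotient.mk_eq_zero,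
      ← Submodule.mkQ_apply, map_sum]
    simpa only [map_smul, Submodule.mkQ_apply, hC] using hy i
  choose E hE using hrow
  have hEC : ∀ i j, ∑ l, E i l * D l j = ∑ l, D i l * C l j := fun i j => by
    simpa using congrFun (hE i) j
  obtain ⟨e, he⟩ := hD.exists_end E C hEC
  have hte : (torMap R e 1).app X t = τ.app X t := by
    refine hD.isTorClass_unique (ht.mapLeft e E C he hEC) ?_
    have hy' : (fun l => ∑ j, C l j • transposeGen D j) = y :=
      funext fun l => (sum_smul_transposeGen D (C l)).trans (hC l)
    exact hy' ▸ hty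
  refine ⟨e, ?_⟩
  ext M s
  let Q : ProjectiveResolution M := projectiveResolution M
  -- A Yoneda-type argument: `s` is the image of `t` under a map from the transpose, so naturality
  -- reduces the claim to `hte`.
  obtain ⟨x, hx, hs⟩ := hD.exists_isTorClass_of_tor Q s
  obtain ⟨f, hf⟩ := exists_transpose_linearMap D x hx
  have hts : (Tor R A 1).map (ModuleCat.ofHom f : X ⟶ M) t = s := by
    refine hD.isTorClass_unique (ht.map Q (ModuleCat.ofHom f : X ⟶ M)) ?_
    simpa [hf] using hs
  have h1 := ConcreteCategory.congr_hom ((torMap R e 1).naturality (ModuleCat.ofHom f : X ⟶ M)) t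
  have h2 := ConcreteCategory.congr_hom (τ.naturality (ModuleCat.ofHom f : X ⟶ M)) t
  rw [ConcreteCategory.comp_apply, ConcreteCategory.comp_apply, hts] at h1 h2
  exact h1.trans ((congrArg _ hte).trans h2.symm)

end NatTrans

/-! ### Splitting the idempotent -/

section Summand

variable {R : Type u} [Ring R] {A : Type u} [AddCommGroup A] [Module Rᵐᵒᵖ A]

/-- Only the induced map is idempotent, not `e` itself. The exponent must be positive, as `e ^ 0`
induces the identity. -/
theorem torMap_pow {e : Module.End Rᵐᵒᵖ A} {n : ℕ} (he : torMap R e n ≫ torMap R e n = torMap R e n)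
    (k : ℕ) : torMap R (e ^ (k + 1)) n = torMap R e n := by
  induction k with
  | zero => rw [zero_add, pow_one]
  | succ k ih => rw [pow_succ, Module.End.mul_eq_comp, torMap_comp, ih, he]

theorem bijective_rangeRestrict_comp_subtype {f : A →ₗ[Rᵐᵒᵖ] A}
    (hf : IsCompl (LinearMap.ker f) (LinearMap.range f)) :
    Function.Bijective (f.rangeRestrict ∘ₗ (LinearMap.range f).subtype) := by
  constructor
  · rw [← LinearMap.ker_eq_bot, LinearMap.ker_comp, LinearMap.ker_rangeRestrict,
      ← Submodule.disjoint_iff_comap_eq_bot]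
    exact hf.disjoint.symm
  · rintro ⟨_, x, rfl⟩
    obtain ⟨y, hy, z, hz, rfl⟩ := Submodule.mem_sup.1 (hf.sup_eq_top ▸ Submodule.mem_top (x := x))
    exact ⟨⟨z, hz⟩, Subtype.ext (by simp [LinearMap.mem_ker.1 hy])⟩

/-- If an idempotent endomorphism of `T` factors as `r ≫ i` through `S` with `i ≫ r` invertible,
then its image is `S`. -/
theorem nonempty_iso_of_retract {C : Type*} [Category C] {F T S : C} (ρ : Retract F T)
    (r : T ⟶ S) (i : S ⟶ T) (h : r ≫ i = ρ.r ≫ ρ.i) [IsIso (i ≫ r)] : Nonempty (F ≅ S) := by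
  -- As `r ≫ i` is idempotent, the cube of `i ≫ r` equals its square; cancelling the invertible `i ≫
  -- r` twice gives the identity.
  have hid : i ≫ r = 𝟙 S := by
    rw [← cancel_mono (i ≫ r), ← cancel_mono (i ≫ r), Category.id_comp]
    have h2 : r ≫ i ≫ r ≫ i = r ≫ i := by
      rw [reassoc_of% h, h, ρ.retract_assoc]
    simp only [Category.assoc]
    rw [reassoc_of% h2]
  exact ⟨{ hom := ρ.i ≫ r, inv := i ≫ ρ.r
           hom_inv_id := by simp [reassoc_of% h]
           inv_hom_id := by simp [← reassoc_of% h, hid] }⟩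

end Summand

end NCTensor

theorem proposition4p10 (Λ : Type u) [Ring Λ] (A : Type u) [AddCommGroup A] [Module Λᵐᵒᵖ A]
    (hfp : Module.FinitePresentation Λᵐᵒᵖ A) (hfl : IsFiniteLength Λᵐᵒᵖ A)
    (F : ModuleCat.{u} Λ ⥤ AddCommGrpCat.{u}) (hF : Nonempty (Retract F (NCTensor.Tor Λ A 1))) :
    ∃ B : Submodule Λᵐᵒᵖ A, Module.FinitePresentation Λᵐᵒᵖ B ∧ IsFiniteLength Λᵐᵒᵖ B ∧
      Nonempty (F ≅ NCTensor.Tor Λ B 1) := by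
  obtain ⟨ρ⟩ := hF
  obtain ⟨_, _⟩ := isFiniteLength_iff_isNoetherian_isArtinian.1 hfl
  obtain ⟨e, he⟩ := NCTensor.exists_torMap_eq hfp (ρ.r ≫ ρ.i)
  -- Fitting's lemma, from finite length. The exponent `k + 1` below is both at least `k` and
  -- positive.
  obtain ⟨k, hk⟩ := Filter.eventually_atTop.1 (LinearMap.eventually_isCompl_ker_pow_range_pow e)
  let f : A →ₗ[Λᵐᵒᵖ] A := e ^ (k + 1)
  have hf : NCTensor.torMap Λ f 1 = ρ.r ≫ ρ.i := by
    rw [NCTensor.torMap_pow (by simp [he]), he]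
  -- The image is a quotient of `A` by a kernel that is finitely generated, `A` being Noetherian.
  refine ⟨LinearMap.range f, Module.finitePresentation_of_surjective f.rangeRestrict
    f.surjective_rangeRestrict (IsNoetherian.noetherian _),
    isFiniteLength_iff_isNoetherian_isArtinian.2 ⟨inferInstance, inferInstance⟩, ?_⟩
  let g := LinearEquiv.ofBijective _
    (NCTensor.bijective_rangeRestrict_comp_subtype (f := f) (hk (k + 1) k.le_succ))
  have : IsIso (NCTensor.torMap Λ (LinearMap.range f).subtype 1 ≫
      NCTensor.torMap Λ f.rangeRestrict 1) := by
    rw [← NCTensor.torMap_comp]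
    refine ⟨NCTensor.torMap Λ g.symm.toLinearMap 1, ?_, ?_⟩
    · rw [← NCTensor.torMap_comp, ← NCTensor.torMap_id]
      congr 1
      exact LinearMap.ext g.symm_apply_apply
    · rw [← NCTensor.torMap_comp, ← NCTensor.torMap_id]
      congr 1
      exact LinearMap.ext g.apply_symm_apply
  refine NCTensor.nonempty_iso_of_retract ρ (NCTensor.torMap Λ f.rangeRestrict 1)
    (NCTensor.torMap Λ (LinearMap.range f).subtype 1) ?_
  rw [← NCTensor.torMap_comp, ← hf]
  rfl
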